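/- Let $\kappa$ be a regular cardinal and let $\lambda<\kappa$ be an infinite cardinal. A $\lambda$-indexed chain in a category is a functor out of $\lambda$, viewed as a well-ordered set. Let $\mathbf{CAT}$ be the $2$-category of locally small categories, and let $\mathbf{ACC}_{\lambda,\kappa}\subset\mathbf{CAT}$ be the following $2$-subcategory: its objects are the $\kappa$-accessible categories in which all $\lambda$-indexed chains have colimits, its $1$-cells are the functors preserving $\kappa$-directed colimits and colimits of $\lambda$-indexed chains, and its $2$-cells are all natural transformations between such functors. Let $\Gamma$ be a (strict) $2$-category with fewer than $\kappa$ objects, fewer than $\kappa$ $1$-cells and fewer than $\kappa$ $2$-cells, and let $H\colon\Gamma\to\mathbf{ACC}_{\lambda,\kappa}$ be a (strict) $2$-functor. The (conical) oplax limit $M$ of $H$ is the following category. An object of $M$ consists of an object $M_\gamma\in H(\gamma)$ for every object $\gamma\in\Gamma$ and a morphism $m_a\colon M_\delta\to H(a)(M_\gamma)$ in $H(\delta)$ for every $1$-cell $a\colon\gamma\to\delta$ of $\Gamma$, such that $m_{\mathrm{id}_\gamma}=\mathrm{id}_{M_\gamma}$ for every object $\gamma$; $m_{ba}=H(b)(m_a)\circ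 m_b$ for all composable $1$-cells $a\colon\gamma\to\delta$ and $b\colon\delta\to\epsilon$; and $H(t)_{M_\gamma}\circ m_a=m_b$ for every $2$-cell $t\colon a\to b$ between $1$-cells $a,b\colon\gamma\rightrightarrows\delta$. A morphism $f\colon L\to M$ is a family of morphisms $f_\gamma\colon L_\gamma\to M_\gamma$ in $H(\gamma)$ with $H(a)(f_\gamma)\circ l_a=m_a\circ f_\delta$ for every $1$-cell $a\colon\gamma\to\delta$, where $l_a$ and $m_a$ are the structure morphisms of $L$ and $M$. Then: 1. $M$ belongs to $\mathbf{ACC}_{\lambda,\kappa}$, that is, $M$ is a $\kappa$-accessible category in which all $\lambda$-indexed chains have colimits. 2. For every object $\gamma\in\Gamma$, the projection functor $M\to H(\gamma)$ is a $1$-cell of $\mathbf{ACC}_{\lambda,\kappa}$, that is, it preserves $\kappa$-directed colimits and colimits of $\lambda$-indexed chains. 3. An object $S\in M$ is $\kappa$-presentable if and only if, for every object $\gamma\in\Gamma$, its component $S_\gamma$ is $\kappa$-presentable in $H(\gamma)$. -/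

import Mathlib

open CategoryTheory CategoryTheory.Limits

universe w w₁ v₁ u₁ v u v' u'

namespace AccLimits

/-- A 2-category has fewer than `κ` objects, fewer than `κ` 1-cells and fewer than `κ` 2-cells. -/
structure IsCardinalSmall (Γ : Type u₁) [Bicategory.{w₁, v₁} Γ] (κ : Cardinal.{w}) : Prop where
  objects : HasCardinalLT Γ κ
  oneCells : HasCardinalLT (Σ (γ : Γ) (δ : Γ), (γ ⟶ δ)) κ
  twoCells : HasCardinalLT (Σ (γ : Γ) (δ : Γ) (a : γ ⟶ δ) (b : γ ⟶ δ), (a ⟶ b)) κ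

/-- The objects of the 2-category `ACC_{lam, κ}`: the `κ`-accessible (in particular, locally small)
categories having colimits of `lam`-indexed chains, where a chain is a functor out of the cardinal
`lam` viewed as a well-ordered set. -/
structure IsACCObject (lam κ : Cardinal.{w}) [Fact κ.IsRegular]
    (C : Type u) [Category.{v} C] : Prop where
  isCardinalAccessibleCategory : IsCardinalAccessibleCategory C κ
  hasColimitsOfChains : HasColimitsOfShape lam.ord.ToType C

/-- The 1-cells of the 2-category `ACC_{lam, κ}`: the functors preserving `κ`-filtered colimits and
colimits of `lam`-indexed chains. -/
structure IsACCOneCell (lam κ : Cardinal.{w}) [Fact κ.IsRegular]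
    {C : Type u} [Category.{v} C] {D : Type u'} [Category.{v'} D] (F : C ⥤ D) : Prop where
  isCardinalAccessible : F.IsCardinalAccessible κ
  preservesColimitsOfChains : PreservesColimitsOfShape lam.ord.ToType F

section

variable {Γ : Type u₁} [Bicategory.{w₁, v₁} Γ]

/-- A 2-functor to the 2-category of categories takes values in its sub-2-category
`ACC_{lam, κ}`. All the natural transformations between 1-cells of `ACC_{lam, κ}` are 2-cells of
`ACC_{lam, κ}`, so that there is no condition on 2-cells. -/
structure LandsInACC (lam κ : Cardinal.{w}) [Fact κ.IsRegular]
    (H : StrictPseudofunctor Γ Cat.{v, u}) : Prop where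
  obj (γ : Γ) : IsACCObject lam κ (H.obj γ)
  map {γ δ : Γ} (a : γ ⟶ δ) : IsACCOneCell lam κ (H.map a).toFunctor

variable (H : StrictPseudofunctor Γ Cat.{v, u})

/-- The (conical) oplax limit of a 2-functor `H` with values in categories. Its objects are families
of objects `obj γ` of `H γ` together with morphisms `str a : obj δ ⟶ H(a) (obj γ)` for all 1-cells
`a : γ ⟶ δ`, subject to unitality, multiplicativity and compatibility with 2-cells.
Here `H.mapId γ : H(𝟙 γ) ≅ 𝟙` and `H.mapComp a b : H(a ≫ b) ≅ H(a) ≫ H(b)` are the identities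
given by strictness of `H`; they only serve to make the equations well typed. -/
structure OplaxLimit where
  obj (γ : Γ) : H.obj γ
  str {γ δ : Γ} (a : γ ⟶ δ) : obj δ ⟶ (H.map a).toFunctor.obj (obj γ)
  str_id (γ : Γ) : str (𝟙 γ) = (H.mapId γ).inv.toNatTrans.app (obj γ)
  str_comp {γ δ ε : Γ} (a : γ ⟶ δ) (b : δ ⟶ ε) :
    str (a ≫ b) = str b ≫ (H.map b).toFunctor.map (str a) ≫
      (H.mapComp a b).inv.toNatTrans.app (obj γ)
  str_map₂ {γ δ : Γ} {a b : γ ⟶ δ} (t : a ⟶ b) :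
    str a ≫ (H.map₂ t).toNatTrans.app (obj γ) = str b

namespace OplaxLimit

variable {H}

/-- A morphism in the oplax limit is a family of morphisms `L γ ⟶ M γ` compatible with the
structure morphisms of `L` and `M`. -/
@[ext]
structure Hom (L M : OplaxLimit H) where
  app (γ : Γ) : L.obj γ ⟶ M.obj γ
  comm {γ δ : Γ} (a : γ ⟶ δ) :
    L.str a ≫ (H.map a).toFunctor.map (app γ) = app δ ≫ M.str a

instance : Category (OplaxLimit H) where
  Hom L M := Hom L M
  id L :=
    { app := fun γ => 𝟙 (L.obj γ)
      comm := fun a => by simp }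
  comp f g :=
    { app := fun γ => f.app γ ≫ g.app γ
      comm := fun a => by
        rw [Functor.map_comp, ← Category.assoc, f.comm, Category.assoc, g.comm, Category.assoc] }
  id_comp f := Hom.ext (funext fun γ => Category.id_comp (f.app γ))
  comp_id f := Hom.ext (funext fun γ => Category.comp_id (f.app γ))
  assoc f g h := Hom.ext (funext fun γ => Category.assoc (f.app γ) (g.app γ) (h.app γ))

variable (H)

/-- The projection functor from the oplax limit to `H γ`. -/
def proj (γ : Γ) : OplaxLimit H ⥤ H.obj γ where
  obj M := M.obj γ
  map f := Hom.app f γ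
  map_id _ := rfl
  map_comp _ _ := rfl

end OplaxLimit

end

end AccLimits

/-! Colimits in the oplax limit are computed componentwise. A structure morphism goes from `M_δ` to
`H(a)(M_γ)`, so on a colimit it is induced by the universal property of the source alone. Hence the
projections preserve these colimits. An object with `κ`-presentable components is `κ`-presentable: a
morphism out of it consists of fewer than `κ` components subject to fewer than `κ` equations, and
the functors `H(a)` preserve `κ`-filtered colimits.

The main point is that every `M` is a `κ`-filtered colimit of such objects
(`isCardinalFilteredGenerator`). All components `M_γ` are written as colimits of `κ`-presentable
objects `E_γ(x)` over one `κ`-directed preorder `A`. The structure of `M` does not restrict to a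
single index `x`: by presentability, `E_δ(lo) ⟶ M_δ ⟶ H(a)(M_γ)` factors only through some later
`H(a)(E_γ(hi))`, and the axioms hold only later still. Such a partial structure is a `Step`, and
`Step.exists_refines` bounds any fewer than `κ` steps by one that also enforces their axioms.
Iterating along the ordinal `λ` gives a `Chain`. In its colimit the delay disappears, leaving an
object of the oplax limit whose components are colimits of `λ < κ` presentable objects, hence
presentable. The chains form a `κ`-directed preorder and their colimits have colimit `M`.

Finally, a `κ`-presentable object is a retract of a generator of this kind, and projections preserve
retracts, so its components are presentable. -/

namespace AccLimits

/-! ### Morphisms, structure equations and componentwise colimits in the oplax limit. -/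

namespace OplaxLimit

section

variable {Γ : Type u₁} [Bicategory.{w₁, v₁} Γ] (H : StrictPseudofunctor Γ Cat.{v, u})

/-- The functor underlying the image of a 1-cell. -/
abbrev fct {γ δ : Γ} (a : γ ⟶ δ) : H.obj γ ⥤ H.obj δ := (H.map a).toFunctor

/-- The unit constraint of `H`, as a natural transformation between functors. -/
def unitTrans (γ : Γ) : 𝟭 (H.obj γ) ⟶ fct H (𝟙 γ) := (H.mapId γ).inv.toNatTrans

/-- The composition constraint of `H`, as a natural transformation between functors. -/
def compTrans {γ δ ε : Γ} (a : γ ⟶ δ) (b : δ ⟶ ε) : fct H a ⋙ fct H b ⟶ fct H (a ≫ b) :=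
  (H.mapComp a b).inv.toNatTrans

/-- The image of a 2-cell, as a natural transformation between functors. -/
def twoCellTrans {γ δ : Γ} {a b : γ ⟶ δ} (t : a ⟶ b) : fct H a ⟶ fct H b :=
  (H.map₂ t).toNatTrans

lemma unitTrans_naturality {γ : Γ} {X Y : H.obj γ} (f : X ⟶ Y) :
    f ≫ (unitTrans H γ).app Y = (unitTrans H γ).app X ≫ (fct H (𝟙 γ)).map f :=
  (unitTrans H γ).naturality f

lemma compTrans_naturality {γ δ ε : Γ} (a : γ ⟶ δ) (b : δ ⟶ ε) {X Y : H.obj γ} (f : X ⟶ Y) :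
    (fct H b).map ((fct H a).map f) ≫ (compTrans H a b).app Y =
      (compTrans H a b).app X ≫ (fct H (a ≫ b)).map f :=
  (compTrans H a b).naturality f

variable {H}

@[ext]
lemma hom_ext {L M : OplaxLimit H} {f g : L ⟶ M} (h : ∀ γ, Hom.app f γ = Hom.app g γ) : f = g :=
  Hom.ext (funext h)

@[simp]
lemma comp_app {L M N : OplaxLimit H} (f : L ⟶ M) (g : M ⟶ N) (γ : Γ) :
    Hom.app (f ≫ g) γ = Hom.app f γ ≫ Hom.app g γ := rfl

lemma hom_comm {L M : OplaxLimit H} (f : L ⟶ M) {γ δ : Γ} (a : γ ⟶ δ) :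
    L.str a ≫ (fct H a).map (Hom.app f γ) = Hom.app f δ ≫ M.str a :=
  Hom.comm f a

/-- Constructor for objects of the oplax limit. -/
def mk' (obj : ∀ γ, H.obj γ) (str : ∀ {γ δ : Γ} (a : γ ⟶ δ), obj δ ⟶ (fct H a).obj (obj γ))
    (str_id : ∀ γ, str (𝟙 γ) = (unitTrans H γ).app (obj γ))
    (str_comp : ∀ {γ δ ε : Γ} (a : γ ⟶ δ) (b : δ ⟶ ε),
      str (a ≫ b) = str b ≫ (fct H b).map (str a) ≫ (compTrans H a b).app (obj γ))
    (str_map₂ : ∀ {γ δ : Γ} {a b : γ ⟶ δ} (t : a ⟶ b),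
      str a ≫ (twoCellTrans H t).app (obj γ) = str b) : OplaxLimit H where
  obj := obj
  str := str
  str_id := str_id
  str_comp := str_comp
  str_map₂ := str_map₂

lemma str_id' (L : OplaxLimit H) (γ : Γ) : L.str (𝟙 γ) = (unitTrans H γ).app (L.obj γ) :=
  L.str_id γ

lemma str_comp' (L : OplaxLimit H) {γ δ ε : Γ} (a : γ ⟶ δ) (b : δ ⟶ ε) :
    L.str (a ≫ b) = L.str b ≫ (fct H b).map (L.str a) ≫ (compTrans H a b).app (L.obj γ) :=
  L.str_comp a b

lemma str_map₂' (L : OplaxLimit H) {γ δ : Γ} {a b : γ ⟶ δ} (t : a ⟶ b) :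
    L.str a ≫ (twoCellTrans H t).app (L.obj γ) = L.str b :=
  L.str_map₂ t

/-- Constructor for morphisms of the oplax limit. -/
def homMk {L M : OplaxLimit H} (app : ∀ γ, L.obj γ ⟶ M.obj γ)
    (comm : ∀ {γ δ : Γ} (a : γ ⟶ δ), L.str a ≫ (fct H a).map (app γ) = app δ ≫ M.str a) :
    L ⟶ M :=
  { app := app, comm := comm : Hom L M }

@[simp]
lemma homMk_app {L M : OplaxLimit H} (app : ∀ γ, L.obj γ ⟶ M.obj γ)
    (comm : ∀ {γ δ : Γ} (a : γ ⟶ δ), L.str a ≫ (fct H a).map (app γ) = app δ ≫ M.str a)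
    (γ : Γ) : Hom.app (homMk app comm) γ = app γ := rfl

/-! ### Colimits -/

section Colimits

variable {K : Type u'} [Category.{v'} K]

section

variable {F : K ⥤ OplaxLimit H} {c : Cocone F} (hc : ∀ γ, IsColimit ((proj H γ).mapCocone c))

/-- The components of morphisms out of a pointwise colimit. -/
def descApp (s : Cocone F) (γ : Γ) : c.pt.obj γ ⟶ s.pt.obj γ :=
  (hc γ).desc ((proj H γ).mapCocone s)

lemma fac_descApp (s : Cocone F) (γ : Γ) (k : K) :
    Hom.app (c.ι.app k) γ ≫ descApp hc s γ = Hom.app (s.ι.app k) γ :=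
  (hc γ).fac ((proj H γ).mapCocone s) k

lemma hom_ext_of_proj {F : K ⥤ OplaxLimit H} {c : Cocone F}
    (hc : ∀ γ, IsColimit ((proj H γ).mapCocone c)) {γ : Γ} {Z : H.obj γ} {f g : c.pt.obj γ ⟶ Z}
    (h : ∀ k, Hom.app (c.ι.app k) γ ≫ f = Hom.app (c.ι.app k) γ ≫ g) : f = g :=
  (hc γ).hom_ext h

/-- The projections jointly reflect colimits. -/
def isColimitOfProj : IsColimit c where
  desc s := homMk (descApp hc s) (fun {γ δ} a => by
    refine hom_ext_of_proj hc fun k => ?_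
    rw [reassoc_of% @fac_descApp]
    erw [← reassoc_of% @hom_comm]
    rw [← Functor.map_comp, fac_descApp, hom_comm]
    rfl)
  fac s k := by
    ext γ
    exact fac_descApp hc s γ k
  uniq s m hm := by
    ext γ
    refine hom_ext_of_proj hc fun k => ?_
    rw [homMk_app, fac_descApp, ← hm]
    rfl

end

section

variable (F : K ⥤ OplaxLimit H) (c : ∀ γ, Cocone (F ⋙ proj H γ)) (hc : ∀ γ, IsColimit (c γ))

/-- The coprojections of a family of cocones. -/
def leg (γ : Γ) (k : K) : (F.obj k).obj γ ⟶ (c γ).pt := (c γ).ι.app k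

lemma app_leg (γ : Γ) {k l : K} (f : k ⟶ l) : Hom.app (F.map f) γ ≫ leg F c γ l = leg F c γ k :=
  (c γ).w f

lemma leg_hom_ext (F : K ⥤ OplaxLimit H) (c : ∀ γ, Cocone (F ⋙ proj H γ))
    (hc : ∀ γ, IsColimit (c γ)) {γ : Γ} {Z : H.obj γ} {f g : (c γ).pt ⟶ Z}
    (h : ∀ k, leg F c γ k ≫ f = leg F c γ k ≫ g) : f = g :=
  (hc γ).hom_ext h

/-- The structure morphisms of a pointwise colimit. -/
def colimStr {γ δ : Γ} (a : γ ⟶ δ) : (c δ).pt ⟶ (fct H a).obj (c γ).pt :=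
  -- Only the colimit property at `δ` enters; `H(a)` need not preserve the colimit at `γ`.
  (hc δ).desc (Cocone.mk ((fct H a).obj (c γ).pt)
    { app := fun k => (F.obj k).str a ≫ (fct H a).map (leg F c γ k)
      naturality := fun k l f => by
        refine Eq.trans ?_ (Category.comp_id _).symm
        change Hom.app (F.map f) δ ≫ (F.obj l).str a ≫ (fct H a).map (leg F c γ l) = _
        rw [← reassoc_of% @hom_comm, ← Functor.map_comp, app_leg]
        rfl })

lemma leg_colimStr {γ δ : Γ} (a : γ ⟶ δ) (k : K) :
    leg F c δ k ≫ colimStr F c hc a = (F.obj k).str a ≫ (fct H a).map (leg F c γ k) :=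
  (hc δ).fac _ k

/-- The pointwise colimit. -/
def colimObj : OplaxLimit H :=
  mk' (fun γ => (c γ).pt) (colimStr F c hc)
    (fun γ => leg_hom_ext F c hc fun k => by
      rw [leg_colimStr, str_id', ← unitTrans_naturality])
    (fun {γ δ ε} a b => leg_hom_ext F c hc fun k => by
      rw [leg_colimStr, reassoc_of% @leg_colimStr, str_comp', ← Functor.map_comp_assoc,
        leg_colimStr,
        Functor.map_comp_assoc, compTrans_naturality]
      simp only [Category.assoc])
    (fun {γ δ a b} t => leg_hom_ext F c hc fun k => by
      rw [leg_colimStr, reassoc_of% @leg_colimStr, ← str_map₂' _ t, Category.assoc,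
        NatTrans.naturality])

/-- The colimit cocone with the pointwise colimit as its point. -/
def colimCocone : Cocone F where
  pt := colimObj F c hc
  ι :=
    { app := fun k => homMk (leg F c · k) (fun a => (leg_colimStr F c hc a k).symm)
      naturality := fun k l f => by
        ext γ
        exact (c γ).ι.naturality f }

/-- The projections of `colimCocone` are colimit cocones. -/
def isColimitMapColimCocone (γ : Γ) : IsColimit ((proj H γ).mapCocone (colimCocone F c hc)) :=
  IsColimit.ofIsoColimit (hc γ) (Cocone.ext (Iso.refl _) fun _ => Category.comp_id _)

/-- `colimCocone` is a colimit. -/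
def isColimitColimCocone : IsColimit (colimCocone F c hc) :=
  isColimitOfProj (isColimitMapColimCocone F c hc)

end

lemma hasColimitsOfShape (h : ∀ γ, HasColimitsOfShape K (H.obj γ)) :
    HasColimitsOfShape K (OplaxLimit H) where
  has_colimit F := ⟨⟨⟨_, isColimitColimCocone F _ fun _ => colimit.isColimit _⟩⟩⟩

lemma preservesColimitsOfShape_proj (h : ∀ γ, HasColimitsOfShape K (H.obj γ)) (γ : Γ) :
    PreservesColimitsOfShape K (proj H γ) where
  preservesColimit {F} := preservesColimit_of_preserves_colimit_cocone
    (isColimitColimCocone F _ fun _ => colimit.isColimit _)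
    (isColimitMapColimCocone F _ (fun _ => colimit.isColimit _) γ)

end Colimits

end

end OplaxLimit

end AccLimits

/-! ### Presentability and smallness of objects with presentable components. -/

namespace AccLimits

section

variable {Γ : Type u₁} [Bicategory.{w₁, v₁} Γ] {κ : Cardinal.{w}}

lemma IsCardinalSmall.hasCardinalLT_hom (h : IsCardinalSmall Γ κ) (γ δ : Γ) :
    HasCardinalLT (γ ⟶ δ) κ :=
  h.oneCells.of_injective (fun a => ⟨γ, δ, a⟩) fun a b hab => by simpa using hab

lemma IsCardinalSmall.hasCardinalLT_hom₂ (h : IsCardinalSmall Γ κ) {γ δ : Γ} (a b : γ ⟶ δ) :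
    HasCardinalLT (a ⟶ b) κ :=
  h.twoCells.of_injective (fun t => ⟨γ, δ, a, b, t⟩) fun s t hst => by simpa using hst

lemma IsCardinalSmall.small (h : IsCardinalSmall Γ κ) : Small.{w} Γ := h.objects.small

lemma IsCardinalSmall.small_hom (h : IsCardinalSmall Γ κ) (γ δ : Γ) : Small.{w} (γ ⟶ δ) :=
  (h.hasCardinalLT_hom γ δ).small

end

namespace OplaxLimit

section

variable {Γ : Type u₁} [Bicategory.{w₁, v₁} Γ] {H : StrictPseudofunctor Γ Cat.{v, u}}
  {κ : Cardinal.{w}} [Fact κ.IsRegular]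

/-- The components factor through a common stage because `Γ` has fewer than `κ` objects. The
factorizations need not commute with the structure morphisms there, but they do after passing to the
colimit, hence at a later stage common to all 1-cells. -/
lemma exists_hom_of_isColimit (hΓ : IsCardinalSmall Γ κ)
    (hmap : ∀ {γ δ : Γ} (a : γ ⟶ δ), (fct H a).IsCardinalAccessible κ)
    (S : OplaxLimit H) (hS : ∀ γ, IsCardinalPresentable (S.obj γ) κ)
    {J : Type w} [SmallCategory J] [IsCardinalFiltered J κ] {F : J ⥤ OplaxLimit H} {c : Cocone F}
    (hc : ∀ γ, IsColimit ((proj H γ).mapCocone c)) (f : S ⟶ c.pt) :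
    ∃ (j : J) (g : S ⟶ F.obj j), g ≫ c.ι.app j = f := by
  have h₁ (γ : Γ) : ∃ (j : J) (g : S.obj γ ⟶ (F.obj j).obj γ),
      g ≫ Hom.app (c.ι.app j) γ = Hom.app f γ :=
    IsCardinalPresentable.exists_hom_of_isColimit κ (hc γ) (Hom.app f γ)
  choose j g hg using h₁
  obtain ⟨j₀, g₀, hg₀⟩ : ∃ (j₀ : J) (g₀ : ∀ γ, S.obj γ ⟶ (F.obj j₀).obj γ),
      ∀ γ, g₀ γ ≫ Hom.app (c.ι.app j₀) γ = Hom.app f γ :=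
    ⟨IsCardinalFiltered.max j hΓ.objects,
      fun γ => g γ ≫ Hom.app (F.map (IsCardinalFiltered.toMax j hΓ.objects γ)) γ, fun γ => by
      rw [Category.assoc, ← comp_app]
      erw [c.w, hg]⟩
  -- For one 1-cell: the two sides of the square agree in the colimit, which `H(a)` preserves, and
  -- `S.obj δ` is presentable.
  have h₂ (a : Σ (γ : Γ) (δ : Γ), (γ ⟶ δ)) : ∃ (k : J) (r : j₀ ⟶ k),
      (S.str a.2.2 ≫ (fct H a.2.2).map (g₀ a.1)) ≫
          (fct H a.2.2).map (Hom.app (F.map r) a.1) =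
        (g₀ a.2.1 ≫ (F.obj j₀).str a.2.2) ≫ (fct H a.2.2).map (Hom.app (F.map r) a.1) := by
    obtain ⟨γ, δ, a⟩ := a
    have := (fct H a).preservesColimitsOfShape_of_isCardinalAccessible κ J
    refine IsCardinalPresentable.exists_eq_of_isColimit' (X := S.obj δ) κ
      (isColimitOfPreserves (fct H a) (hc γ)) (i := j₀) _ _ ?_
    change (S.str a ≫ (fct H a).map (g₀ γ)) ≫ (fct H a).map (Hom.app (c.ι.app j₀) γ) =
      (g₀ δ ≫ (F.obj j₀).str a) ≫ (fct H a).map (Hom.app (c.ι.app j₀) γ)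
    rw [Category.assoc, ← Functor.map_comp]
    erw [hg₀]
    rw [hom_comm, ← hg₀, Category.assoc, Category.assoc]
    erw [← hom_comm]
  choose k r hr using h₂
  obtain ⟨m, s, b, hb⟩ := IsCardinalFiltered.wideSpan r hΓ.oneCells
  refine ⟨m, homMk (fun γ => g₀ γ ≫ Hom.app (F.map b) γ) (fun {γ δ} a => ?_), ?_⟩
  · have h := hr ⟨γ, δ, a⟩
    dsimp only at h
    rw [← hb ⟨γ, δ, a⟩, F.map_comp, comp_app, comp_app, Functor.map_comp, Functor.map_comp,
      Category.assoc, Category.assoc, ← hom_comm]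
    simp only [Category.assoc] at h
    rw [reassoc_of% h, ← reassoc_of% @hom_comm]
  · ext γ
    rw [comp_app, homMk_app, Category.assoc, ← comp_app, c.w]
    exact hg₀ γ

lemma exists_eq_of_isColimit (hΓ : IsCardinalSmall Γ κ)
    (S : OplaxLimit H) (hS : ∀ γ, IsCardinalPresentable (S.obj γ) κ)
    {J : Type w} [SmallCategory J] [IsCardinalFiltered J κ] {F : J ⥤ OplaxLimit H} {c : Cocone F}
    (hc : ∀ γ, IsColimit ((proj H γ).mapCocone c)) {j : J} (f g : S ⟶ F.obj j)
    (h : f ≫ c.ι.app j = g ≫ c.ι.app j) :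
    ∃ (k : J) (r : j ⟶ k), f ≫ F.map r = g ≫ F.map r := by
  have h₁ (γ : Γ) : ∃ (k : J) (r : j ⟶ k),
      Hom.app f γ ≫ Hom.app (F.map r) γ = Hom.app g γ ≫ Hom.app (F.map r) γ :=
    IsCardinalPresentable.exists_eq_of_isColimit' κ (hc γ) _ _
      (congrArg (fun f => Hom.app f γ) h)
  choose k r hr using h₁
  obtain ⟨m, s, b, hb⟩ := IsCardinalFiltered.wideSpan r hΓ.objects
  refine ⟨m, b, ?_⟩
  ext γ
  rw [comp_app, comp_app, ← hb γ, Functor.map_comp, comp_app, reassoc_of% hr γ]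

/-- An object of the oplax limit whose components are `κ`-presentable is `κ`-presentable. -/
lemma isCardinalPresentable_of_components (hΓ : IsCardinalSmall Γ κ)
    (hcolim : ∀ γ, HasCardinalFilteredColimits (H.obj γ) κ)
    (hmap : ∀ {γ δ : Γ} (a : γ ⟶ δ), (fct H a).IsCardinalAccessible κ)
    (S : OplaxLimit H) (hS : ∀ γ, IsCardinalPresentable (S.obj γ) κ) :
    IsCardinalPresentable S κ where
  preservesColimitOfShape J _ _ := ⟨fun {F} => ⟨fun {c} hc => ⟨by
    have := isFiltered_of_isCardinalFiltered J κ
    have hJ (γ : Γ) := preservesColimitsOfShape_proj (K := J)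
      (fun γ => (hcolim γ).hasColimitsOfShape J) γ
    have hc' (γ : Γ) : IsColimit ((proj H γ).mapCocone c) := isColimitOfPreserves (proj H γ) hc
    refine Types.FilteredColimit.isColimitOf' _ _ (fun f => ?_) (fun j f g h => ?_)
    · obtain ⟨j, g, hg⟩ := exists_hom_of_isColimit hΓ hmap S hS hc' f
      exact ⟨j, g, hg.symm⟩
    · exact exists_eq_of_isColimit hΓ S hS hc' f g h⟩⟩⟩

/-- The oplax limit of locally small categories is locally small. -/
lemma locallySmall (hΓ : Small.{w} Γ) (h : ∀ γ, LocallySmall.{w} (H.obj γ)) :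
    LocallySmall.{w} (OplaxLimit H) where
  hom_small L M := small_of_injective (β := ∀ γ, L.obj γ ⟶ M.obj γ) (f := fun f γ => Hom.app f γ)
    (fun _ _ hfg => hom_ext fun γ => congrFun hfg γ)

/-- Transport of an object of the oplax limit along isomorphisms of its components. -/
def transport (L : OplaxLimit H) {X : ∀ γ, H.obj γ} (e : ∀ γ, L.obj γ ≅ X γ) : OplaxLimit H :=
  mk' X (fun {γ δ} a => (e δ).inv ≫ L.str a ≫ (fct H a).map (e γ).hom)
    (fun γ => by
      rw [str_id', ← unitTrans_naturality, Iso.inv_hom_id_assoc])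
    (fun {γ δ ε} a b => by
      simp only [Category.assoc, Functor.map_comp]
      rw [← (fct H b).map_comp_assoc, Iso.hom_inv_id, (fct H b).map_id, Category.id_comp,
        compTrans_naturality, str_comp']
      simp only [Category.assoc])
    (fun {γ δ a b} t => by
      rw [← str_map₂' _ t]
      simp only [Category.assoc, NatTrans.naturality])

/-- An object of the oplax limit is isomorphic to its transports. -/
def transportIso (L : OplaxLimit H) {X : ∀ γ, H.obj γ} (e : ∀ γ, L.obj γ ≅ X γ) :
    L ≅ L.transport e where
  hom := homMk (fun γ => (e γ).hom) (fun {γ δ} a => ((e δ).hom_inv_id_assoc _).symm)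
  inv := homMk (fun γ => (e γ).inv) (fun {γ δ} a => by
    change ((e δ).inv ≫ L.str a ≫ (fct H a).map (e γ).hom) ≫ (fct H a).map (e γ).inv = _
    rw [Category.assoc, Category.assoc, ← (fct H a).map_comp, Iso.hom_inv_id, (fct H a).map_id,
      Category.comp_id]
    rfl)
  hom_inv_id := by ext γ; exact (e γ).hom_inv_id
  inv_hom_id := by ext γ; exact (e γ).inv_hom_id

/-- The objects of the oplax limit whose components satisfy given properties. -/
def componentwise (P : ∀ γ, ObjectProperty (H.obj γ)) : ObjectProperty (OplaxLimit H) :=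
  fun L => ∀ γ, P γ (L.obj γ)

lemma small_componentwise (hΓ : Small.{w} Γ) (hΓ' : ∀ γ δ : Γ, Small.{w} (γ ⟶ δ))
    (h : ∀ γ, LocallySmall.{w} (H.obj γ)) (P : ∀ γ, ObjectProperty (H.obj γ))
    [∀ γ, ObjectProperty.Small.{w} (P γ)] :
    ObjectProperty.Small.{w} (componentwise P) := by
  have (γ : Γ) : Small.{w} (Subtype (P γ)) := inferInstanceAs (ObjectProperty.Small (P γ))
  refine small_of_injective (β := Σ X : ∀ γ, Subtype (P γ), ∀ (γ δ : Γ) (a : γ ⟶ δ),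
      (X δ).1 ⟶ (fct H a).obj (X γ).1)
    (f := fun L => ⟨fun γ => ⟨L.1.obj γ, L.2 γ⟩, fun γ δ a => L.1.str a⟩) ?_
  rintro ⟨⟨X, s, _, _, _⟩, hX⟩ ⟨⟨Y, t, _, _, _⟩, hY⟩ hXY
  obtain rfl : X = Y := by
    funext γ
    exact congrArg (fun z => (z.1 γ).1) hXY
  have hst := eq_of_heq (Sigma.mk.inj hXY).2
  obtain rfl : @s = @t := by
    funext γ δ a
    exact congrFun (congrFun (congrFun hst γ) δ) a
  rfl

/-- Structure transports along componentwise isomorphisms, so the components may be taken in small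
sets of representatives. -/
lemma essentiallySmall_componentwise (hΓ : Small.{w} Γ) (hΓ' : ∀ γ δ : Γ, Small.{w} (γ ⟶ δ))
    (h : ∀ γ, LocallySmall.{w} (H.obj γ)) (P : ∀ γ, ObjectProperty (H.obj γ))
    [∀ γ, ObjectProperty.EssentiallySmall.{w} (P γ)] :
    ObjectProperty.EssentiallySmall.{w} (componentwise P) := by
  choose Q _ hPQ using fun γ => ObjectProperty.EssentiallySmall.exists_small_le' (P γ)
  have := small_componentwise hΓ hΓ' h Q
  refine ⟨componentwise Q, inferInstance, fun L hL => ?_⟩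
  choose X hX e using fun γ => hPQ γ _ (hL γ)
  exact ⟨L.transport fun γ => (e γ).some, hX, ⟨L.transportIso _⟩⟩

end

end OplaxLimit

end AccLimits

/-! ### Directed preorders and eventual properties. -/

namespace AccLimits

section Directed

variable {A : Type u'} [Preorder A] {κ : Cardinal.{w}} [Fact κ.IsRegular]

lemma isCardinalFiltered_of_exists_bound
    (h : ∀ ⦃K : Type w⦄ (s : K → A), HasCardinalLT K κ → ∃ x, ∀ k, s k ≤ x) :
    IsCardinalFiltered A κ where
  nonempty_cocone {K _} F hK := by
    obtain ⟨x, hx⟩ := h F.obj (hasCardinalLT_of_hasCardinalLT_arrow hK)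
    exact ⟨Cocone.mk x { app := fun k => homOfLE (hx k), naturality := fun _ _ _ => rfl }⟩

lemma exists_bound (κ : Cardinal.{w}) [Fact κ.IsRegular] [IsCardinalFiltered A κ]
    {K : Type v'} (hK : HasCardinalLT K κ) (s : K → A) : ∃ x, ∀ k, s k ≤ x :=
  ⟨IsCardinalFiltered.max s hK, fun k => leOfHom (IsCardinalFiltered.toMax s hK k)⟩

lemma eventually_of_upwardClosed {Q : A → Prop} (x : A) (hx : ∀ y, x ≤ y → Q y) :
    ∀ᶠ y in Filter.atTop, Q y :=
  (Filter.eventually_ge_atTop x).mono hx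

lemma exists_forall_of_eventually (κ : Cardinal.{w}) [Fact κ.IsRegular] [IsCardinalFiltered A κ]
    {Q : A → Prop} (h : ∀ᶠ y in Filter.atTop, Q y) :
    ∃ x, ∀ y, x ≤ y → Q y := by
  have := isFiltered_of_isCardinalFiltered A κ
  have : Nonempty A := IsFiltered.nonempty
  have : IsDirectedOrder A := ⟨fun x y => ⟨IsFiltered.max x y,
    leOfHom (IsFiltered.leftToMax x y), leOfHom (IsFiltered.rightToMax x y)⟩⟩
  exact Filter.eventually_atTop.1 h

/-- The filter `atTop` of a `κ`-directed preorder is closed under intersections of fewer than `κ`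
sets. This lets all requirements on a step be met at a single index. -/
lemma eventually_forall (κ : Cardinal.{w}) [Fact κ.IsRegular] [IsCardinalFiltered A κ]
    {K : Type v'} (hK : HasCardinalLT K κ) {Q : K → A → Prop}
    (h : ∀ k, ∀ᶠ y in Filter.atTop, Q k y) : ∀ᶠ y in Filter.atTop, ∀ k, Q k y := by
  choose s hs using fun k => exists_forall_of_eventually κ (h k)
  obtain ⟨x, hx⟩ := exists_bound κ hK s
  exact eventually_of_upwardClosed x fun y hy k => hs k y ((hx k).trans hy)

end Directed

/-! ### Approximations by presentable objects and partial structures. -/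

namespace OplaxLimit

section

variable {Γ : Type u₁} [Bicategory.{w₁, v₁} Γ] {H : StrictPseudofunctor Γ Cat.{v, u}}

/-- Diagrams indexed by a common preorder whose colimits are the components of an object of the
oplax limit. -/
structure Approximation (M : OplaxLimit H) (A : Type u') [Preorder A] where
  /-- The diagram with colimit `M.obj γ`. -/
  diag (γ : Γ) : A ⥤ H.obj γ
  /-- The coprojections. -/
  ι (γ : Γ) (x : A) : (diag γ).obj x ⟶ M.obj γ
  map_ι (γ : Γ) {x y : A} (f : x ⟶ y) : (diag γ).map f ≫ ι γ y = ι γ x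
  /-- The colimit property. -/
  isColimit (γ : Γ) : IsColimit (Cocone.mk (M.obj γ)
    { app := ι γ, naturality := fun _ _ f => (map_ι γ f).trans (Category.comp_id _).symm })

namespace Approximation

variable {M : OplaxLimit H} {A : Type u'} [Preorder A] (E : Approximation M A)

/-- The values of the diagrams of an approximation. -/
def obj (γ : Γ) (x : A) : H.obj γ := (E.diag γ).obj x

/-- The transition maps of an approximation. -/
def tr (γ : Γ) {x y : A} (h : x ≤ y) : E.obj γ x ⟶ E.obj γ y := (E.diag γ).map (homOfLE h)

/-- The coprojections of an approximation. -/
def inj (γ : Γ) (x : A) : E.obj γ x ⟶ M.obj γ := E.ι γ x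

@[simp]
lemma tr_refl (γ : Γ) (x : A) : E.tr γ (le_refl x) = 𝟙 _ := (E.diag γ).map_id x

@[simp]
lemma tr_tr (γ : Γ) {x y z : A} (h : x ≤ y) (h' : y ≤ z) :
    E.tr γ h ≫ E.tr γ h' = E.tr γ (h.trans h') :=
  ((E.diag γ).map_comp (homOfLE h) (homOfLE h')).symm

@[simp]
lemma tr_inj (γ : Γ) {x y : A} (h : x ≤ y) : E.tr γ h ≫ E.inj γ y = E.inj γ x :=
  E.map_ι γ (homOfLE h)

lemma hom_ext {γ : Γ} {Z : H.obj γ} {f g : M.obj γ ⟶ Z}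
    (h : ∀ x, E.inj γ x ≫ f = E.inj γ x ≫ g) : f = g :=
  (E.isColimit γ).hom_ext h

lemma exists_desc {γ : Γ} {Z : H.obj γ} (φ : ∀ x, E.obj γ x ⟶ Z)
    (hφ : ∀ {x y} (h : x ≤ y), E.tr γ h ≫ φ y = φ x) :
    ∃ f : M.obj γ ⟶ Z, ∀ x, E.inj γ x ≫ f = φ x :=
  ⟨(E.isColimit γ).desc (Cocone.mk Z
    { app := φ, naturality := fun _ _ f => (hφ (leOfHom f)).trans (Category.comp_id _).symm }),
    fun x => (E.isColimit γ).fac _ x⟩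

section

variable {κ : Cardinal.{w}} [Fact κ.IsRegular] [IsCardinalFiltered A κ] [Small.{w} A]
  {γ δ : Γ} (a : γ ⟶ δ) (ha : (fct H a).IsCardinalAccessible κ)
  {X : H.obj δ} (hX : IsCardinalPresentable X κ)

include ha hX

lemma eventually_exists_factorization (f : X ⟶ (fct H a).obj (M.obj γ)) :
    ∀ᶠ y in Filter.atTop, ∃ g : X ⟶ (fct H a).obj (E.obj γ y),
      g ≫ (fct H a).map (E.inj γ y) = f := by
  have := essentiallySmall_of_small_of_locallySmall.{w} A
  have := (fct H a).preservesColimitsOfShape_of_isCardinalAccessible_of_essentiallySmall κ A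
  obtain ⟨x, g, hg⟩ : ∃ (x : A) (g : X ⟶ (fct H a).obj (E.obj γ x)),
      g ≫ (fct H a).map (E.inj γ x) = f :=
    IsCardinalPresentable.exists_hom_of_isColimit κ
      (isColimitOfPreserves (fct H a) (E.isColimit γ)) f
  refine eventually_of_upwardClosed x fun y hxy => ⟨g ≫ (fct H a).map (E.tr γ hxy), ?_⟩
  rw [Category.assoc, ← (fct H a).map_comp, tr_inj]
  exact hg

lemma eventually_coequalize {x : A} (f g : X ⟶ (fct H a).obj (E.obj γ x))
    (h : f ≫ (fct H a).map (E.inj γ x) = g ≫ (fct H a).map (E.inj γ x)) :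
    ∀ᶠ y in Filter.atTop, ∀ hxy : x ≤ y,
      f ≫ (fct H a).map (E.tr γ hxy) = g ≫ (fct H a).map (E.tr γ hxy) := by
  have := essentiallySmall_of_small_of_locallySmall.{w} A
  have := (fct H a).preservesColimitsOfShape_of_isCardinalAccessible_of_essentiallySmall κ A
  obtain ⟨z, r, hr⟩ := IsCardinalPresentable.exists_eq_of_isColimit' κ
    (isColimitOfPreserves (fct H a) (E.isColimit γ)) (i := x) f g h
  have hr' : f ≫ (fct H a).map (E.tr γ (leOfHom r)) = g ≫ (fct H a).map (E.tr γ (leOfHom r)) := hr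
  refine eventually_of_upwardClosed z fun y hzy hxy => ?_
  rw [← E.tr_tr γ (leOfHom r) hzy, (fct H a).map_comp, reassoc_of% hr']

end

/-- A partially defined structure of an object of the oplax limit over `M` on the values of an
approximation: the structure morphisms lead from the value at `lo` to the value at `hi`. -/
structure Step where
  /-- The index of the sources of the structure morphisms. -/
  lo : A
  /-- The index of the targets of the structure morphisms. -/
  hi : A
  le : lo ≤ hi
  /-- The structure morphisms. -/
  str {γ δ : Γ} (a : γ ⟶ δ) : E.obj δ lo ⟶ (fct H a).obj (E.obj γ hi)
  w {γ δ : Γ} (a : γ ⟶ δ) : str a ≫ (fct H a).map (E.inj γ hi) = E.inj δ lo ≫ M.str a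

namespace Step

variable {E}

instance : Preorder (Step E) where
  le s t := ∃ (h₁ : s.lo ≤ t.lo) (h₂ : s.hi ≤ t.hi), ∀ {γ δ : Γ} (a : γ ⟶ δ),
    s.str a ≫ (fct H a).map (E.tr γ h₂) = E.tr δ h₁ ≫ t.str a
  le_refl s := ⟨le_rfl, le_rfl, fun {γ δ} a => by simp⟩
  le_trans := by
    rintro r s t ⟨h₁, h₂, h⟩ ⟨h₁', h₂', h'⟩
    refine ⟨h₁.trans h₁', h₂.trans h₂', fun {γ δ} a => ?_⟩
    rw [← E.tr_tr γ h₂ h₂', (fct H a).map_comp, reassoc_of% h a, h' a, reassoc_of% @tr_tr]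

lemma lo_le_lo {s t : Step E} (h : s ≤ t) : s.lo ≤ t.lo := h.1

lemma hi_le_hi {s t : Step E} (h : s ≤ t) : s.hi ≤ t.hi := h.2.1

lemma str_naturality {s t : Step E} (h : s ≤ t) {γ δ : Γ} (a : γ ⟶ δ) :
    s.str a ≫ (fct H a).map (E.tr γ (hi_le_hi h)) = E.tr δ (lo_le_lo h) ≫ t.str a :=
  h.2.2 a

/-- The condition that the partial structure `t` extends the partial structure `s`, and that the
axioms of objects of the oplax limit hold for the structure morphisms of `s` when they are extended
by those of `t`. -/
structure Refines (s t : Step E) : Prop where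
  hi_le_lo : s.hi ≤ t.lo
  nat {γ δ : Γ} (a : γ ⟶ δ) :
    s.str a ≫ (fct H a).map (E.tr γ (hi_le_lo.trans t.le)) =
      E.tr δ (s.le.trans hi_le_lo) ≫ t.str a
  str_id (γ : Γ) :
    s.str (𝟙 γ) ≫ (fct H (𝟙 γ)).map (E.tr γ (hi_le_lo.trans t.le)) =
      E.tr γ (s.le.trans (hi_le_lo.trans t.le)) ≫ (unitTrans H γ).app (E.obj γ t.hi)
  str_comp {γ δ ε : Γ} (a : γ ⟶ δ) (b : δ ⟶ ε) :
    s.str (a ≫ b) ≫ (fct H (a ≫ b)).map (E.tr γ (hi_le_lo.trans t.le)) =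
      s.str b ≫ (fct H b).map (E.tr δ hi_le_lo ≫ t.str a) ≫ (compTrans H a b).app (E.obj γ t.hi)
  str_map₂ {γ δ : Γ} {a b : γ ⟶ δ} (r : a ⟶ b) :
    s.str a ≫ (fct H a).map (E.tr γ (hi_le_lo.trans t.le)) ≫ (twoCellTrans H r).app (E.obj γ t.hi) =
      s.str b ≫ (fct H b).map (E.tr γ (hi_le_lo.trans t.le))

lemma Refines.le {s t : Step E} (h : Refines s t) : s ≤ t :=
  ⟨s.le.trans h.hi_le_lo, h.hi_le_lo.trans t.le, h.nat⟩

section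

variable {κ : Cardinal.{w}} [Fact κ.IsRegular] [IsCardinalFiltered A κ] [Small.{w} A]
  (hΓ : IsCardinalSmall Γ κ)
  (hmap : ∀ {γ δ : Γ} (a : γ ⟶ δ), (fct H a).IsCardinalAccessible κ)
  (hE : ∀ γ x, IsCardinalPresentable (E.obj γ x) κ)

include hΓ hmap hE

/-- Every required equation holds after mapping to `M`, by the axioms of `M`. Its source is
presentable, so it holds at all sufficiently large indices, and there are fewer than `κ` equations.
-/
lemma exists_refines (x : A) {K : Type w} (hK : HasCardinalLT K κ) (s : K → Step E) :
    ∃ t : Step E, x ≤ t.lo ∧ ∀ k, Refines (s k) t := by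
  obtain ⟨lo, hlo⟩ := exists_forall_of_eventually κ <|
    (Filter.eventually_ge_atTop x).and (eventually_forall κ hK fun k =>
      Filter.eventually_ge_atTop (s k).hi)
  obtain ⟨hx, hlo⟩ := hlo lo le_rfl
  -- At `y` the structure morphisms of `M` restricted to `lo` factor, but these factorizations need
  -- not yet be compatible with the given steps.
  obtain ⟨y, hy⟩ := exists_forall_of_eventually κ <|
    (Filter.eventually_ge_atTop lo).and <| eventually_forall κ hΓ.objects fun γ =>
      eventually_forall κ hΓ.objects fun δ => eventually_forall κ (hΓ.hasCardinalLT_hom γ δ)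
        fun a => E.eventually_exists_factorization a (hmap a) (hE δ lo) (E.inj δ lo ≫ M.str a)
  obtain ⟨hlo_y, hy⟩ := hy y le_rfl
  choose f hf using hy
  have h_nat := eventually_forall κ hK fun k => eventually_forall κ hΓ.objects fun γ =>
    eventually_forall κ hΓ.objects fun δ => eventually_forall κ (hΓ.hasCardinalLT_hom γ δ)
      fun a => E.eventually_coequalize a (hmap a) (hE δ (s k).lo)
        ((s k).str a ≫ (fct H a).map (E.tr γ ((hlo k).trans hlo_y)))
        (E.tr δ ((s k).le.trans (hlo k)) ≫ f γ δ a) (by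
          rw [Category.assoc, Category.assoc, ← (fct H a).map_comp, E.tr_inj, (s k).w, hf,
            reassoc_of% @tr_inj])
  have h_id := eventually_forall κ hK fun k => eventually_forall κ hΓ.objects fun γ =>
    E.eventually_coequalize (𝟙 γ) (hmap _) (hE γ (s k).lo)
      ((s k).str (𝟙 γ) ≫ (fct H (𝟙 γ)).map (E.tr γ ((hlo k).trans hlo_y)))
      (E.tr γ ((s k).le.trans ((hlo k).trans hlo_y)) ≫ (unitTrans H γ).app (E.obj γ y)) (by
        rw [Category.assoc, Category.assoc, ← (fct H (𝟙 γ)).map_comp, E.tr_inj, (s k).w,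
          ← unitTrans_naturality, str_id', reassoc_of% @tr_inj])
  have h_comp := eventually_forall κ hK fun k => eventually_forall κ hΓ.objects fun γ =>
    eventually_forall κ hΓ.objects fun δ => eventually_forall κ hΓ.objects fun ε =>
    eventually_forall κ (hΓ.hasCardinalLT_hom γ δ) fun a =>
    eventually_forall κ (hΓ.hasCardinalLT_hom δ ε) fun b =>
      E.eventually_coequalize (a ≫ b) (hmap _) (hE ε (s k).lo)
        ((s k).str (a ≫ b) ≫ (fct H (a ≫ b)).map (E.tr γ ((hlo k).trans hlo_y)))
        ((s k).str b ≫ (fct H b).map (E.tr δ (hlo k) ≫ f γ δ a) ≫ (compTrans H a b).app (E.obj γ y)) (by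
          simp only [Category.assoc]
          rw [← (fct H (a ≫ b)).map_comp, E.tr_inj, (s k).w, ← compTrans_naturality,
            ← (fct H b).map_comp_assoc, Category.assoc, hf, reassoc_of% @tr_inj, (fct H b).map_comp,
            str_comp', Category.assoc, reassoc_of% (s k).w b])
  have h_map₂ := eventually_forall κ hK fun k => eventually_forall κ hΓ.objects fun γ =>
    eventually_forall κ hΓ.objects fun δ => eventually_forall κ (hΓ.hasCardinalLT_hom γ δ) fun a =>
    eventually_forall κ (hΓ.hasCardinalLT_hom γ δ) fun b =>
    eventually_forall κ (hΓ.hasCardinalLT_hom₂ a b) fun r =>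
      E.eventually_coequalize b (hmap _) (hE δ (s k).lo)
        ((s k).str a ≫ (fct H a).map (E.tr γ ((hlo k).trans hlo_y)) ≫ (twoCellTrans H r).app (E.obj γ y))
        ((s k).str b ≫ (fct H b).map (E.tr γ ((hlo k).trans hlo_y))) (by
          simp only [Category.assoc]
          rw [← (twoCellTrans H r).naturality, ← (fct H a).map_comp_assoc,
            ← (fct H b).map_comp, E.tr_inj, reassoc_of% (s k).w a, (s k).w, str_map₂'])
  -- Pushing the factorizations from `y` to `hi` makes all the equations hold at once.
  obtain ⟨hi, hhi⟩ := exists_forall_of_eventually κ <| (Filter.eventually_ge_atTop y).and <|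
    h_nat.and <| h_id.and <| h_comp.and h_map₂
  obtain ⟨hy_hi, h_nat, h_id, h_comp, h_map₂⟩ := hhi hi le_rfl
  refine ⟨{ lo := lo, hi := hi, le := hlo_y.trans hy_hi
            str := fun {γ δ} a => f γ δ a ≫ (fct H a).map (E.tr γ hy_hi)
            w := fun {γ δ} a => by
              rw [Category.assoc, ← (fct H a).map_comp, E.tr_inj, hf] }, hx, fun k => ?_⟩
  refine ⟨hlo k, fun {γ δ} a => ?_, fun γ => ?_, fun {γ δ ε} a b => ?_, fun {γ δ a b} r => ?_⟩
  · simpa only [Category.assoc, ← (fct H a).map_comp, E.tr_tr] using h_nat k γ δ a hy_hi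
  · have h := h_id k γ hy_hi
    rw [Category.assoc, Category.assoc, ← unitTrans_naturality, ← (fct H (𝟙 γ)).map_comp,
      E.tr_tr, reassoc_of% @tr_tr] at h
    exact h
  · have h := h_comp k γ δ ε a b hy_hi
    simp only [Category.assoc] at h
    rw [← compTrans_naturality, ← (fct H (a ≫ b)).map_comp, E.tr_tr,
      ← (fct H b).map_comp_assoc, Category.assoc] at h
    exact h
  · have h := h_map₂ k γ δ a b r hy_hi
    simp only [Category.assoc] at h
    rw [← (twoCellTrans H r).naturality, ← (fct H a).map_comp_assoc, ← (fct H b).map_comp,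
      E.tr_tr] at h
    exact h

/-- Well-founded recursion on `I`: the step at `i` refines the given family together with all
earlier steps, which are fewer than `κ` in total. -/
lemma exists_chain (I : Type w) [LinearOrder I] [WellFoundedLT I] (hI : HasCardinalLT I κ)
    (x : A) {K : Type w} (hK : HasCardinalLT K κ) (s : K → Step E) :
    ∃ c : I → Step E, (∀ i, x ≤ (c i).lo) ∧ (∀ k i, Refines (s k) (c i)) ∧
      ∀ ⦃i j⦄, i < j → Refines (c i) (c j) := by
  have h (i : I) (f : ∀ j, j < i → Step E) : ∃ t : Step E, x ≤ t.lo ∧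
      ∀ k : K ⊕ { j // j < i }, Refines (Sum.elim s (fun j => f j.1 j.2) k) t :=
    exists_refines hΓ hmap hE x
      ((hasCardinalLT_sum_iff _ _ _ (Cardinal.IsRegular.aleph0_le Fact.out)).2
        ⟨hK, hI.of_injective _ Subtype.val_injective⟩) _
  choose t ht using h
  let c : I → Step E := wellFounded_lt.fix t
  have hc (i : I) : c i = t i (fun j _ => c j) := wellFounded_lt.fix_eq t i
  refine ⟨c, fun i => ?_, fun k i => ?_, fun i j hij => ?_⟩
  · rw [hc]
    exact (ht i _).1
  · rw [hc]
    exact (ht i _).2 (Sum.inl k)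
  · rw [hc j]
    exact (ht j fun k _ => c k).2 (Sum.inr ⟨i, hij⟩)

end

end Step

end Approximation

end

/-! ### Chains of partial structures and their colimits. -/

namespace Approximation

section

variable {Γ : Type u₁} [Bicategory.{w₁, v₁} Γ] {H : StrictPseudofunctor Γ Cat.{v, u}}
  {M : OplaxLimit H} {A : Type u'} [Preorder A]

/-- A chain of partial structures, each of which refines all the previous ones. -/
@[ext]
structure Chain (E : Approximation M A) (I : Type w) [LinearOrder I] where
  /-- The partial structures of the chain. -/
  step : I → Step E
  refines ⦃i j : I⦄ : i < j → Step.Refines (step i) (step j)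

namespace Chain

variable {E : Approximation M A} {I : Type w} [LinearOrder I]

/-- Comparing each step with some step of the other chain is enough to induce a morphism between the
colimits (`mapHom`). -/
instance : Preorder (Chain E I) where
  le c d := ∀ i, ∃ j, c.step i ≤ d.step j
  le_refl _ i := ⟨i, le_rfl⟩
  le_trans _ _ _ h h' i := by
    obtain ⟨j, hj⟩ := h i
    obtain ⟨k, hk⟩ := h' j
    exact ⟨k, hj.trans hk⟩

lemma exists_step_le {c d : Chain E I} (h : c ≤ d) (i : I) : ∃ j, c.step i ≤ d.step j := h i

variable (c : Chain E I)

lemma monotone_step {i j : I} (h : i ≤ j) : c.step i ≤ c.step j := by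
  obtain rfl | h := h.eq_or_lt
  · exact le_rfl
  · exact (c.refines h).le

/-- The indices which are bounded by the elements of a chain. -/
def Bounds (x : A) : Prop := ∃ i, x ≤ (c.step i).lo

variable {c} in
lemma Bounds.of_le {x y : A} (hy : c.Bounds y) (h : x ≤ y) : c.Bounds x := by
  obtain ⟨i, hi⟩ := hy
  exact ⟨i, h.trans hi⟩

lemma bounds_lo (i : I) : c.Bounds (c.step i).lo := ⟨i, le_rfl⟩

lemma bounds_hi [NoMaxOrder I] (i : I) : c.Bounds (c.step i).hi := by
  obtain ⟨j, hj⟩ := exists_gt i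
  exact ⟨j, (c.refines hj).hi_le_lo⟩

lemma Bounds.mono {c d : Chain E I} {x : A} (hx : c.Bounds x) (h : c ≤ d) : d.Bounds x := by
  obtain ⟨i, hi⟩ := hx
  obtain ⟨j, hj⟩ := exists_step_le h i
  exact ⟨j, hi.trans (Step.lo_le_lo hj)⟩

/-- The diagram of the values of an approximation on a chain. -/
def diag (γ : Γ) : I ⥤ H.obj γ where
  obj i := E.obj γ (c.step i).lo
  map f := E.tr γ (Step.lo_le_lo (c.monotone_step (leOfHom f)))
  map_id _ := E.tr_refl γ _
  map_comp _ _ := (E.tr_tr γ _ _).symm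

variable [∀ γ, HasColimitsOfShape I (H.obj γ)]

/-- The colimit of the values of an approximation on a chain. -/
noncomputable def pt (γ : Γ) : H.obj γ := colimit (c.diag γ)

/-- The coprojections to the colimit of a chain. -/
noncomputable def coproj (γ : Γ) (i : I) : E.obj γ (c.step i).lo ⟶ c.pt γ := colimit.ι (c.diag γ) i

lemma tr_coproj (γ : Γ) {i j : I} (h : i ≤ j) :
    E.tr γ (Step.lo_le_lo (c.monotone_step h)) ≫ c.coproj γ j = c.coproj γ i :=
  colimit.w (c.diag γ) (homOfLE h)

/-- The morphisms to the colimit of a chain from the values at the indices which it bounds. -/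
noncomputable def into (γ : Γ) {x : A} (hx : c.Bounds x) : E.obj γ x ⟶ c.pt γ :=
  E.tr γ hx.choose_spec ≫ c.coproj γ hx.choose

/-- The choice of a bounding step in `into` is immaterial, since any two steps of a chain are
comparable. -/
lemma into_eq (γ : Γ) {x : A} (hx : c.Bounds x) {i : I} (h : x ≤ (c.step i).lo) :
    c.into γ hx = E.tr γ h ≫ c.coproj γ i := by
  obtain h' | h' := le_total i hx.choose
  · rw [into, ← c.tr_coproj γ h', reassoc_of% @tr_tr]
  · rw [into, ← c.tr_coproj γ h', reassoc_of% @tr_tr]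

lemma tr_into (γ : Γ) {x y : A} (h : x ≤ y) (hy : c.Bounds y) :
    E.tr γ h ≫ c.into γ hy = c.into γ (hy.of_le h) := by
  rw [into, reassoc_of% @tr_tr]
  exact (c.into_eq γ _ _).symm

lemma into_lo (γ : Γ) (i : I) : c.into γ (c.bounds_lo i) = c.coproj γ i := by
  rw [c.into_eq γ _ le_rfl, E.tr_refl, Category.id_comp]

variable {c} in
lemma hom_ext {γ : Γ} {Z : H.obj γ} {f g : c.pt γ ⟶ Z}
    (h : ∀ i, c.into γ (c.bounds_lo i) ≫ f = c.into γ (c.bounds_lo i) ≫ g) : f = g :=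
  colimit.hom_ext fun i => by
    have hi := h i
    rw [into_lo] at hi
    exact hi

/-- Morphisms out of the colimit of a chain. -/
noncomputable def desc {γ : Γ} {Z : H.obj γ} (φ : ∀ i, E.obj γ (c.step i).lo ⟶ Z)
    (hφ : ∀ (i j : I) (h : i ≤ j),
      E.tr γ (Step.lo_le_lo (c.monotone_step h)) ≫ φ j = φ i) : c.pt γ ⟶ Z :=
  colimit.desc (c.diag γ) (Cocone.mk Z
    { app := φ, naturality := fun _ _ f => (hφ _ _ (leOfHom f)).trans (Category.comp_id _).symm })

lemma into_lo_desc {γ : Γ} {Z : H.obj γ} (φ : ∀ i, E.obj γ (c.step i).lo ⟶ Z)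
    (hφ : ∀ (i j : I) (h : i ≤ j),
      E.tr γ (Step.lo_le_lo (c.monotone_step h)) ≫ φ j = φ i) (i : I) :
    c.into γ (c.bounds_lo i) ≫ c.desc φ hφ = φ i := by
  rw [into_lo]
  exact colimit.ι_desc _ i

variable [NoMaxOrder I]

/-- The structure morphisms of the colimit of a chain. -/
noncomputable def str {γ δ : Γ} (a : γ ⟶ δ) : c.pt δ ⟶ (fct H a).obj (c.pt γ) :=
  c.desc (fun i => (c.step i).str a ≫ (fct H a).map (c.into γ (c.bounds_hi i))) fun i j h => by
    rw [← reassoc_of% Step.str_naturality (c.monotone_step h) a, ← (fct H a).map_comp, tr_into]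

lemma into_lo_str {γ δ : Γ} (a : γ ⟶ δ) (i : I) :
    c.into δ (c.bounds_lo i) ≫ c.str a =
      (c.step i).str a ≫ (fct H a).map (c.into γ (c.bounds_hi i)) :=
  c.into_lo_desc _ _ i

/-- The colimit of a chain, as an object of the oplax limit. -/
noncomputable def colim : OplaxLimit H :=
  mk' c.pt c.str
    (fun γ => hom_ext fun i => by
      -- The axioms for step `i` hold only after extension to a later step, which exists as `I` has
      -- no maximum.
      obtain ⟨j, hj⟩ := exists_gt i
      have h := c.refines hj
      have hij := h.hi_le_lo.trans (c.step j).le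
      rw [into_lo_str, ← c.tr_into γ hij (c.bounds_hi j), (fct H (𝟙 γ)).map_comp,
        reassoc_of% h.str_id γ, ← unitTrans_naturality, reassoc_of% @tr_into])
    (fun {γ δ ε} a b => hom_ext fun i => by
      obtain ⟨j, hj⟩ := exists_gt i
      have h := c.refines hj
      have hij := h.hi_le_lo.trans (c.step j).le
      rw [into_lo_str, ← c.tr_into γ hij (c.bounds_hi j), (fct H (a ≫ b)).map_comp,
        reassoc_of% h.str_comp a b, ← compTrans_naturality, reassoc_of% @into_lo_str,
        ← (fct H b).map_comp_assoc, ← (fct H b).map_comp_assoc, Category.assoc, ← into_lo_str,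
        reassoc_of% @tr_into])
    (fun {γ δ a b} r => hom_ext fun i => by
      obtain ⟨j, hj⟩ := exists_gt i
      have h := c.refines hj
      have hij := h.hi_le_lo.trans (c.step j).le
      rw [into_lo_str, reassoc_of% @into_lo_str, ← c.tr_into γ hij (c.bounds_hi j),
        (fct H a).map_comp, (fct H b).map_comp, Category.assoc, (twoCellTrans H r).naturality,
        ← reassoc_of% h.str_map₂ r])

/-- The components of the canonical morphism from the colimit of a chain. -/
noncomputable def toApp (γ : Γ) : c.pt γ ⟶ M.obj γ :=
  c.desc (fun i => E.inj γ (c.step i).lo) fun _ _ _ => E.tr_inj γ _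

omit [NoMaxOrder I] in
lemma into_toApp (γ : Γ) {x : A} (hx : c.Bounds x) : c.into γ hx ≫ c.toApp γ = E.inj γ x := by
  obtain ⟨i, hi⟩ := id hx
  rw [← c.tr_into γ hi (c.bounds_lo i), Category.assoc, toApp, into_lo_desc, tr_inj]

/-- The canonical morphism from the colimit of a chain. -/
noncomputable def toHom : c.colim ⟶ M :=
  homMk c.toApp fun {γ δ} a => hom_ext fun i => by
    change c.into δ (c.bounds_lo i) ≫ c.str a ≫ (fct H a).map (c.toApp γ) =
      c.into δ (c.bounds_lo i) ≫ c.toApp δ ≫ M.str a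
    rw [reassoc_of% @into_lo_str, ← (fct H a).map_comp, into_toApp, reassoc_of% @into_toApp,
      Step.w]

variable {c} {d e : Chain E I}

/-- The components of the morphisms between the colimits of chains. -/
noncomputable def mapApp (h : c ≤ d) (γ : Γ) : c.pt γ ⟶ d.pt γ :=
  c.desc (fun i => d.into γ ((c.bounds_lo i).mono h)) fun _ _ _ => d.tr_into γ _ _

omit [NoMaxOrder I] in
lemma into_mapApp (h : c ≤ d) (γ : Γ) {x : A} (hx : c.Bounds x) :
    c.into γ hx ≫ mapApp h γ = d.into γ (hx.mono h) := by
  obtain ⟨i, hi⟩ := id hx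
  rw [← c.tr_into γ hi (c.bounds_lo i), Category.assoc, mapApp, into_lo_desc, tr_into]

/-- The morphisms between the colimits of chains. -/
noncomputable def mapHom (h : c ≤ d) : c.colim ⟶ d.colim :=
  homMk (mapApp h) fun {γ δ} a => hom_ext fun i => by
    change c.into δ (c.bounds_lo i) ≫ c.str a ≫ (fct H a).map (mapApp h γ) =
      c.into δ (c.bounds_lo i) ≫ mapApp h δ ≫ d.str a
    obtain ⟨j, hj⟩ := exists_step_le h i
    rw [reassoc_of% @into_lo_str, ← (fct H a).map_comp, into_mapApp, reassoc_of% @into_mapApp,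
      ← d.tr_into δ (Step.lo_le_lo hj) (d.bounds_lo j), Category.assoc, into_lo_str,
      ← reassoc_of% Step.str_naturality hj a, ← (fct H a).map_comp, tr_into]

variable (E I) in
/-- The diagram of the colimits of chains. -/
noncomputable def functor : Chain E I ⥤ OplaxLimit H where
  obj c := c.colim
  map f := mapHom (leOfHom f)
  map_id c := by
    ext γ
    refine hom_ext fun i => ?_
    change c.into γ (c.bounds_lo i) ≫ mapApp (le_refl c) γ = c.into γ (c.bounds_lo i) ≫ 𝟙 (c.pt γ)
    rw [into_mapApp, Category.comp_id]
  map_comp {c d e} f g := by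
    ext γ
    refine hom_ext fun i => ?_
    change c.into γ (c.bounds_lo i) ≫ mapApp ((leOfHom f).trans (leOfHom g)) γ =
      c.into γ (c.bounds_lo i) ≫ mapApp (leOfHom f) γ ≫ mapApp (leOfHom g) γ
    rw [into_mapApp, reassoc_of% @into_mapApp, into_mapApp]

variable (E I) in
/-- The cocone over the diagram of the colimits of chains. -/
noncomputable def cocone : Cocone (functor E I) where
  pt := M
  ι :=
    { app := fun c => c.toHom
      naturality := fun c d f => by
        ext γ
        refine hom_ext fun i => ?_
        change _ ≫ mapApp (leOfHom f) γ ≫ d.toApp γ = _ ≫ c.toApp γ ≫ 𝟙 _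
        rw [Category.comp_id, reassoc_of% @into_mapApp, into_toApp, into_toApp] }

section

variable (hbound : ∀ x : A, ∃ c : Chain E I, c.Bounds x)
  (hdir : ∀ c d : Chain E I, ∃ e, c ≤ e ∧ d ≤ e)

include hbound hdir

omit [NoMaxOrder I] in
-- Every `E.obj γ x` maps into the colimit of some chain, and by directedness its composite to `Z`
-- does not depend on the chain. A cocone on the chain colimits is thus a cocone on the
-- approximation, whose colimit is `M.obj γ`.
lemma exists_desc_of_cocone {γ : Γ} {Z : H.obj γ} (φ : ∀ c : Chain E I, c.pt γ ⟶ Z)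
    (hφ : ∀ {c d : Chain E I} (h : c ≤ d), mapApp h γ ≫ φ d = φ c) :
    ∃ f : M.obj γ ⟶ Z, ∀ c : Chain E I, c.toApp γ ≫ f = φ c := by
  have key {x : A} {c d : Chain E I} (hc : c.Bounds x) (hd : d.Bounds x) :
      c.into γ hc ≫ φ c = d.into γ hd ≫ φ d := by
    obtain ⟨e, hce, hde⟩ := hdir c d
    rw [← hφ hce, ← hφ hde, reassoc_of% into_mapApp hce γ hc, reassoc_of% into_mapApp hde γ hd]
  choose b hb using hbound
  obtain ⟨f, hf⟩ := E.exists_desc (fun x => (b x).into γ (hb x) ≫ φ (b x)) (fun {x y} h => by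
    rw [← Category.assoc, tr_into]
    exact key _ _)
  refine ⟨f, fun c => hom_ext fun i => ?_⟩
  rw [reassoc_of% @into_toApp, hf]
  exact key _ _

omit hdir [NoMaxOrder I] in
lemma hom_ext_of_toApp {γ : Γ} {Z : H.obj γ} {f g : M.obj γ ⟶ Z}
    (h : ∀ c : Chain E I, c.toApp γ ≫ f = c.toApp γ ≫ g) : f = g :=
  E.hom_ext fun x => by
    obtain ⟨c, hc⟩ := hbound x
    rw [← c.into_toApp γ hc, Category.assoc, Category.assoc, h]

/-- `cocone` is componentwise a colimit cocone. -/
lemma nonempty_isColimit_cocone (γ : Γ) :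
    Nonempty (IsColimit ((proj H γ).mapCocone (cocone E I))) := by
  choose f hf using fun s : Cocone (functor E I ⋙ proj H γ) =>
    exists_desc_of_cocone hbound hdir (γ := γ) (Z := s.pt) (fun c => s.ι.app c)
      (fun h => s.w (homOfLE h))
  exact ⟨{
    desc := f
    fac := hf
    uniq := fun s m hm => hom_ext_of_toApp hbound fun c => (hm c).trans (hf s c).symm }⟩

end

end Chain

end

end Approximation

end OplaxLimit

end AccLimits

/-! ### Existence of approximations and the generator. -/

namespace AccLimits

lemma hasCardinalLT_arrow_of_preorder {I : Type u'} [Preorder I] {κ : Cardinal.{w}}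
    (hκ : Cardinal.aleph0 ≤ κ) (hI : HasCardinalLT I κ) : HasCardinalLT (Arrow I) κ :=
  (hasCardinalLT_prod hκ hI hI).of_injective (fun f => (f.left, f.right)) (by
    rintro ⟨a, b, f⟩ ⟨a', b', f'⟩ h
    obtain ⟨h₁, h₂⟩ := Prod.mk.inj h
    obtain rfl : a = a' := h₁
    obtain rfl : b = b' := h₂
    obtain rfl : f = f' := Subsingleton.elim _ _
    rfl)

lemma final_functor_of_surjective {A : Type u} {B : Type u'} [Preorder A] [Preorder B]
    [IsFiltered A] {f : A → B} (hf : Monotone f) (hf' : Function.Surjective f) :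
    hf.functor.Final :=
  Functor.final_of_exists_of_isFiltered _
    (fun b => by
      obtain ⟨a, rfl⟩ := hf' b
      exact ⟨a, ⟨𝟙 _⟩⟩)
    (fun {_ c} _ _ => ⟨c, 𝟙 c, Subsingleton.elim _ _⟩)

/-- The product supplies a common index for the diagrams of all components: its projections are
final by `final_functor_of_surjective`, so reindexing keeps the colimits. -/
lemma exists_product_preorder {ι : Type u} [Small.{w} ι] (α : ι → Type w) [∀ i, Preorder (α i)]
    (κ : Cardinal.{w}) [Fact κ.IsRegular] (h : ∀ i, IsCardinalFiltered (α i) κ) :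
    ∃ (A : Type (max u w)) (_ : Preorder A) (_ : IsCardinalFiltered A κ) (_ : Small.{w} A)
      (f : ∀ i, A → α i), (∀ i, Monotone (f i)) ∧ ∀ i, Function.Surjective (f i) := by
  have hne (i : ι) : Nonempty (α i) := IsCardinalFiltered.nonempty (α i) κ
  refine ⟨∀ i, α i, Pi.preorder, isCardinalFiltered_of_exists_bound fun _ s hK => ?_,
    inferInstance, fun i x => x i, fun i _ _ h => h i, Function.surjective_eval⟩
  choose x hx using fun i => exists_bound κ hK (fun k => s k i)
  exact ⟨x, fun k i => hx i k⟩

/-- A `κ`-filtered category receives a final functor from a `κ`-directed poset, so a presentation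
can be indexed by a poset. -/
lemma exists_directed_presentation {C : Type u} [Category.{v} C] {κ : Cardinal.{w}}
    [Fact κ.IsRegular] [IsCardinalAccessibleCategory C κ] (X : C) :
    ∃ (α : Type w) (_ : PartialOrder α) (_ : IsCardinalFiltered α κ),
      Nonempty ((isCardinalPresentable C κ).ColimitOfShape α X) := by
  obtain ⟨P, _, hP⟩ := HasCardinalFilteredGenerator.exists_generator C κ
  obtain ⟨J, _, _, ⟨p⟩⟩ := hP.exists_colimitsOfShape X
  obtain ⟨α, _, hα, F, _⟩ := IsCardinalFiltered.exists_cardinal_directed J κ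
  exact ⟨α, inferInstance, hα, ⟨(p.ofLE hP.le_isCardinalPresentable).reindex F⟩⟩

namespace OplaxLimit

section

variable {Γ : Type u₁} [Bicategory.{w₁, v₁} Γ] {H : StrictPseudofunctor Γ Cat.{v, u}}
  {κ : Cardinal.{w}} [Fact κ.IsRegular]

lemma exists_approximation (hΓ : IsCardinalSmall Γ κ)
    (hacc : ∀ γ, IsCardinalAccessibleCategory (H.obj γ) κ) (M : OplaxLimit H) :
    ∃ (A : Type (max u₁ w)) (_ : Preorder A) (_ : IsCardinalFiltered A κ) (_ : Small.{w} A)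
      (E : Approximation M A), ∀ γ x, IsCardinalPresentable (E.obj γ x) κ := by
  choose α _ hα p using fun γ => exists_directed_presentation (κ := κ) (M.obj γ)
  have := hΓ.small
  obtain ⟨A, _, hA, _, f, hmono, hsurj⟩ := exists_product_preorder α κ hα
  have := isFiltered_of_isCardinalFiltered A κ
  have hfin (γ : Γ) : (hmono γ).functor.Final := final_functor_of_surjective _ (hsurj γ)
  let q (γ : Γ) := (p γ).some.reindex (hmono γ).functor
  exact ⟨A, inferInstance, hA, inferInstance,
    { diag := fun γ => (q γ).diag
      ι := fun γ x => (q γ).ι.app x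
      map_ι := fun γ _ _ f => ((q γ).ι.naturality f).trans (Category.comp_id _)
      isColimit := fun γ => (q γ).isColimit },
    fun γ x => (q γ).prop_diag_obj x⟩

namespace Approximation

variable {M : OplaxLimit H} {A : Type u'} [Preorder A] [Small.{w} A] (E : Approximation M A)

omit [Fact κ.IsRegular] in
lemma small_step (hΓ : IsCardinalSmall Γ κ) (h : ∀ γ, LocallySmall.{w} (H.obj γ)) :
    Small.{w} (Step E) := by
  have := hΓ.small
  have := hΓ.small_hom
  refine small_of_injective (β := Σ (lo : A) (hi : A), ∀ (γ δ : Γ) (a : γ ⟶ δ),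
      E.obj δ lo ⟶ (fct H a).obj (E.obj γ hi))
    (f := fun s => ⟨s.lo, s.hi, fun γ δ a => s.str a⟩) ?_
  rintro ⟨lo, hi, _, s, _⟩ ⟨lo', hi', _, s', _⟩ h
  obtain rfl : lo = lo' := congrArg (fun z => z.1) h
  have h' := eq_of_heq (Sigma.mk.inj h).2
  obtain rfl : hi = hi' := congrArg (fun z => z.1) h'
  have hs := eq_of_heq (Sigma.mk.inj h').2
  obtain rfl : @s = @s' := by
    funext γ δ a
    exact congrFun (congrFun (congrFun hs γ) δ) a
  rfl

omit [Fact κ.IsRegular] in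
lemma small_chain (hΓ : IsCardinalSmall Γ κ) (h : ∀ γ, LocallySmall.{w} (H.obj γ))
    (I : Type w) [LinearOrder I] : Small.{w} (Chain E I) := by
  have := E.small_step hΓ h
  exact small_of_injective (β := I → Step E) (f := Chain.step) fun _ _ h => Chain.ext h

variable [IsCardinalFiltered A κ] (hΓ : IsCardinalSmall Γ κ)
  (hmap : ∀ {γ δ : Γ} (a : γ ⟶ δ), (fct H a).IsCardinalAccessible κ)
  (hE : ∀ γ x, IsCardinalPresentable (E.obj γ x) κ)
  (I : Type w) [LinearOrder I] [WellFoundedLT I] [Nonempty I] (hI : HasCardinalLT I κ)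

include hΓ hmap hE hI

lemma exists_chain_bounds (x : A) : ∃ c : Chain E I, c.Bounds x := by
  -- No prior steps are prescribed; only the lower bound `x` matters.
  obtain ⟨c, hc, -, hc'⟩ := Step.exists_chain (K := PEmpty) hΓ hmap hE I hI x
    (hasCardinalLT_of_finite _ _ (Cardinal.IsRegular.aleph0_le Fact.out)) PEmpty.elim
  exact ⟨⟨c, hc'⟩, ⟨Classical.arbitrary I, hc _⟩⟩

lemma isCardinalFiltered_chain : IsCardinalFiltered (Chain E I) κ :=
  isCardinalFiltered_of_exists_bound fun K s hK => by
    have := isFiltered_of_isCardinalFiltered A κ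
    -- All steps of all the given chains are refined at once; they are fewer than `κ` by regularity.
    obtain ⟨c, -, hc, hc'⟩ := Step.exists_chain (K := Σ _ : K, I) hΓ hmap hE I hI
      (IsFiltered.nonempty (C := A)).some (hasCardinalLT_sigma _ κ hK fun _ => hI)
      (fun k => (s k.1).step k.2)
    exact ⟨⟨c, hc'⟩, fun k i => ⟨Classical.arbitrary I, (hc ⟨k, i⟩ _).le⟩⟩

end Approximation

lemma Approximation.Chain.isCardinalPresentable_pt {M : OplaxLimit H} {A : Type u'} [Preorder A]
    {E : Approximation M A} {I : Type w} [LinearOrder I] (c : Chain E I)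
    [∀ γ, HasColimitsOfShape I (H.obj γ)] (γ : Γ) [LocallySmall.{w} (H.obj γ)]
    (hE : ∀ x, IsCardinalPresentable (E.obj γ x) κ) (hI : HasCardinalLT I κ) :
    IsCardinalPresentable (c.pt γ) κ := by
  have (i : I) : IsCardinalPresentable ((c.diag γ).obj i) κ := hE _
  exact isCardinalPresentable_of_isColimit _ (colimit.isColimit (c.diag γ)) κ
    (hasCardinalLT_arrow_of_preorder (Cardinal.IsRegular.aleph0_le Fact.out) hI)

/-- The objects of the oplax limit with `κ`-presentable components form a generator. -/
lemma isCardinalFilteredGenerator (hΓ : IsCardinalSmall Γ κ)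
    (hacc : ∀ γ, IsCardinalAccessibleCategory (H.obj γ) κ)
    (hmap : ∀ {γ δ : Γ} (a : γ ⟶ δ), (fct H a).IsCardinalAccessible κ)
    (I : Type w) [LinearOrder I] [WellFoundedLT I] [Nonempty I] [NoMaxOrder I]
    (hI : HasCardinalLT I κ) (hcolim : ∀ γ, HasColimitsOfShape I (H.obj γ)) :
    (componentwise fun γ => isCardinalPresentable (H.obj γ) κ).IsCardinalFilteredGenerator κ where
  le_isCardinalPresentable S hS :=
    isCardinalPresentable_of_components hΓ (fun _ => inferInstance) hmap S hS
  exists_colimitsOfShape M := by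
    obtain ⟨A, _, _, _, E, hE⟩ := exists_approximation hΓ hacc M
    have := E.small_chain hΓ (fun _ => inferInstance) I
    have := E.isCardinalFiltered_chain hΓ hmap hE I hI
    have := isFiltered_of_isCardinalFiltered (Approximation.Chain E I) κ
    have := essentiallySmall_of_small_of_locallySmall.{w} (Approximation.Chain E I)
    -- The chains may live in a larger universe, so the index category is replaced by a small model.
    let e := equivSmallModel.{w} (Approximation.Chain E I)
    have hc (γ : Γ) := Approximation.Chain.nonempty_isColimit_cocone
      (E.exists_chain_bounds hΓ hmap hE I hI)
      (fun c d => ⟨IsFiltered.max c d, leOfHom (IsFiltered.leftToMax c d),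
        leOfHom (IsFiltered.rightToMax c d)⟩) γ
    refine ⟨SmallModel.{w} (Approximation.Chain E I), inferInstance,
      IsCardinalFiltered.of_equivalence κ e, ?_⟩
    rw [← ObjectProperty.colimitsOfShape_congr _ e]
    exact ⟨{
      diag := Approximation.Chain.functor E I
      ι := (Approximation.Chain.cocone E I).ι
      isColimit := isColimitOfProj fun γ => (hc γ).some
      prop_diag_obj := fun c γ => c.isCardinalPresentable_pt γ (hE γ) hI }⟩

end

end OplaxLimit

end AccLimits

/-! ### The theorem. -/

theorem theorem7p1
    (κ lam : Cardinal.{w}) [Fact κ.IsRegular]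
    (hlam : Cardinal.aleph0 ≤ lam) (hlt : lam < κ)
    (Γ : Type u₁) [Bicategory.{w₁, v₁} Γ] [Bicategory.Strict Γ]
    (hΓ : AccLimits.IsCardinalSmall Γ κ)
    (H : StrictPseudofunctor Γ Cat.{v, u}) (hH : AccLimits.LandsInACC lam κ H) :
    AccLimits.IsACCObject lam κ (AccLimits.OplaxLimit H) ∧
      (∀ γ : Γ, AccLimits.IsACCOneCell lam κ (AccLimits.OplaxLimit.proj H γ)) ∧
      ∀ S : AccLimits.OplaxLimit H,
        IsCardinalPresentable S κ ↔
          ∀ γ : Γ, IsCardinalPresentable ((AccLimits.OplaxLimit.proj H γ).obj S) κ := by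
  have hacc (γ : Γ) : IsCardinalAccessibleCategory (H.obj γ) κ :=
    (hH.obj γ).isCardinalAccessibleCategory
  have hchain (γ : Γ) : HasColimitsOfShape lam.ord.ToType (H.obj γ) :=
    (hH.obj γ).hasColimitsOfChains
  have hfilt (J : Type w) [SmallCategory J] [IsCardinalFiltered J κ] (γ : Γ) :
      HasColimitsOfShape J (H.obj γ) := HasCardinalFilteredColimits.hasColimitsOfShape (κ := κ) _ J
  have := Cardinal.noMaxOrder hlam
  have : Nonempty lam.ord.ToType := by
    rw [← Cardinal.mk_ne_zero_iff, Cardinal.mk_ord_toType]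
    exact (Cardinal.aleph0_pos.trans_le hlam).ne'
  have hI : HasCardinalLT lam.ord.ToType κ := by
    rwa [hasCardinalLT_iff_cardinal_mk_lt, Cardinal.mk_ord_toType]
  have hgen := AccLimits.OplaxLimit.isCardinalFilteredGenerator hΓ hacc
    (fun a => (hH.map a).isCardinalAccessible) lam.ord.ToType hI hchain
  have hpres (S : AccLimits.OplaxLimit H) : IsCardinalPresentable S κ ↔
      ∀ γ : Γ, IsCardinalPresentable ((AccLimits.OplaxLimit.proj H γ).obj S) κ := by
    refine ⟨fun hS γ => ?_, fun hS => hgen.le_isCardinalPresentable S hS⟩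
    -- `S` is a retract of an object `T` with presentable components; projecting the retraction
    -- gives the claim.
    rw [← isCardinalPresentable_iff, hgen.isPresentable_eq_retractClosure] at hS
    obtain ⟨T, hT, ⟨r⟩⟩ := hS
    have : IsCardinalPresentable ((AccLimits.OplaxLimit.proj H γ).obj T) κ := hT γ
    exact (r.map (AccLimits.OplaxLimit.proj H γ)).isCardinalPresentable κ
  have hsmall := AccLimits.OplaxLimit.essentiallySmall_componentwise hΓ.small hΓ.small_hom
    (fun _ => inferInstance) (fun γ => isCardinalPresentable (H.obj γ) κ)
  have hloc := AccLimits.OplaxLimit.locallySmall (H := H) hΓ.small (fun _ => inferInstance)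
  -- Local and essential smallness (`hloc`, `hsmall`) turn the generator into an accessibility
  -- datum; with `hfc` this is accessibility.
  have hfg := hgen.hasCardinalFilteredGenerator
  have hfc : HasCardinalFilteredColimits (AccLimits.OplaxLimit H) κ :=
    ⟨fun J _ _ => AccLimits.OplaxLimit.hasColimitsOfShape (hfilt J)⟩
  exact ⟨⟨⟨⟩, AccLimits.OplaxLimit.hasColimitsOfShape hchain⟩,
    fun γ => ⟨⟨fun J _ _ => AccLimits.OplaxLimit.preservesColimitsOfShape_proj (hfilt J) γ⟩,
      AccLimits.OplaxLimit.preservesColimitsOfShape_proj hchain γ⟩, hpres⟩
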